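/- Let $d\in\mathbb N$ and, for $n\in\mathbb Z^d$, put $|n|=\max_{1\le k\le d}|n_k|$. Let $\mathcal H_X,\mathcal H_Y$ be (real or complex) Hilbert spaces and let $\mathbb A=(a_{mn})_{m,n\in\mathbb Z^d}$ be a matrix of bounded linear operators $a_{mn}:\mathcal H_X\to\mathcal H_Y$. Fix a real number $\alpha\ne 0$. For $j\in\mathbb Z^d$ the $j$-th $\alpha$-slant of $\mathbb A$ is the matrix $A_j$ whose $(m,n)$ entry is $a_{mn}$ if $\alpha m_k-n_k\in[j_k,j_k+1)$ for all $k=1,\dots,d$, and $0$ otherwise. Write $\|A_j\|_{\sup}$ for the supremum of the operator norms of the entries of $A_j$. Let $s>(d+1)^2$ and $\omega(j)=(1+|j|)^s$, and suppose that $\mathbb A$ has $\omega$-summable $\alpha$-slants, that is, $$\lceil|\alpha^{-1}|\rceil^d\sum_{j\in\mathbb Z^d}\|A_j\|_{\sup}\,\omega(j)<\infty .$$ Suppose that for some $p\in[1,\infty]$ the matrix $\mathbb A$ is $p$-bb, that is, it defines by $(\mathbb A x)_m=\sum_n a_{mn}x_n$ a bounded operator $\ell^p(\mathbb Z^d,\mathcal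 H_X)\to\ell^p(\mathbb Z^d,\mathcal H_Y)$ and there is $\kappa>0$ with $\|\mathbb A x\|_p\ge\kappa\|x\|_p$ for all $x\in\ell^p(\mathbb Z^d,\mathcal H_X)$. Then for every $q\in[1,\infty]$ the matrix $\mathbb A$ defines a bounded operator $\ell^q(\mathbb Z^d,\mathcal H_X)\to\ell^q(\mathbb Z^d,\mathcal H_Y)$, and its range is a complemented subspace of $\ell^q(\mathbb Z^d,\mathcal H_Y)$, i.e. the image of a bounded linear projection. -/

import Mathlib

open scoped ENNReal

noncomputable section

namespace Slanted

/-- An operator matrix `(a_{mn})`, `m, n ∈ ℤ^d`, of bounded linear operators `a_{mn} : X → Y`. -/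
abbrev OpMatrix (𝕜 : Type*) [RCLike 𝕜] (d : ℕ) (X Y : Type*)
    [NormedAddCommGroup X] [NormedSpace 𝕜 X] [NormedAddCommGroup Y] [NormedSpace 𝕜 Y] :=
  (Fin d → ℤ) → (Fin d → ℤ) → (X →L[𝕜] Y)

/-- The space `ℓ^p(ℤ^d, X)`, with its usual norm. -/
abbrev Ell (d : ℕ) (X : Type*) [NormedAddCommGroup X] (p : ℝ≥0∞) :=
  lp (fun _ : Fin d → ℤ => X) p

section

variable {𝕜 : Type*} [RCLike 𝕜] {d : ℕ} {X Y : Type*}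
  [NormedAddCommGroup X] [NormedSpace 𝕜 X] [NormedAddCommGroup Y] [NormedSpace 𝕜 Y]

/-- The `j`-th `α`-slant of `A`: the entry at `(m, n)` is kept exactly when
`α m_k - n_k ∈ [j_k, j_k + 1)` for all `k`. -/
def slant (α : ℝ) (A : OpMatrix 𝕜 d X Y) (j : Fin d → ℤ) : OpMatrix 𝕜 d X Y :=
  open scoped Classical in
  fun m n => if ∀ k, α * (m k : ℝ) - (n k : ℝ) ∈ Set.Ico (j k : ℝ) ((j k : ℝ) + 1)
    then A m n else 0

/-- `‖A‖_sup = sup_{m,n} ‖a_{mn}‖`, possibly infinite. -/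
def supNorm (A : OpMatrix 𝕜 d X Y) : ℝ≥0∞ := ⨆ m, ⨆ n, ‖A m n‖ₑ

/-- The norm `K ∑_j ‖A_j‖_sup ω(j)`, possibly infinite, where `K = ⌈|α⁻¹|⌉ ^ d`. -/
def slantNorm (α : ℝ) (ω : (Fin d → ℤ) → ℝ) (A : OpMatrix 𝕜 d X Y) : ℝ≥0∞ :=
  ((⌈|α⁻¹|⌉₊ ^ d : ℕ) : ℝ≥0∞) * ∑' j, supNorm (slant α A j) * ENNReal.ofReal (ω j)

/-- `A` has `ω`-summable `α`-slants. -/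
def HasSummableSlants (α : ℝ) (ω : (Fin d → ℤ) → ℝ) (A : OpMatrix 𝕜 d X Y) : Prop :=
  slantNorm α ω A < ∞

/-- The bounded operator `T` on `ℓ^p` is the one given by the matrix `A`:
`(T x)_m = ∑_n a_{mn} x_n`. -/
def IsOperatorOf {p : ℝ≥0∞} [Fact (1 ≤ p)] (A : OpMatrix 𝕜 d X Y)
    (T : Ell d X p →L[𝕜] Ell d Y p) : Prop :=
  ∀ (x : Ell d X p) (m : Fin d → ℤ), HasSum (fun n => A m n (x n)) (T x m)

/-- A matrix determines its operator. -/
theorem IsOperatorOf.unique {p : ℝ≥0∞} [Fact (1 ≤ p)] {A : OpMatrix 𝕜 d X Y}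
    {S T : Ell d X p →L[𝕜] Ell d Y p} (hS : IsOperatorOf A S) (hT : IsOperatorOf A T) :
    S = T := by
  ext x m
  exact (hS x m).unique (hT x m)

/-- `A` is bounded below in `ℓ^p` (`p`-bb): `‖A x‖_p ≥ κ ‖x‖_p` for some `κ > 0` and all
`x ∈ ℓ^p`, where `A` acts on `ℓ^p` as a bounded operator. -/
def IsBoundedBelow (A : OpMatrix 𝕜 d X Y) (p : ℝ≥0∞) [Fact (1 ≤ p)] : Prop :=
  ∃ T : Ell d X p →L[𝕜] Ell d Y p, IsOperatorOf A T ∧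
    ∃ κ : ℝ, 0 < κ ∧ ∀ x : Ell d X p, κ * ‖x‖ ≤ ‖T x‖

end

/-- The weight `ω(j) = (1 + |j|)^s`, where `|j| = max_k |j_k|`. -/
def polyWeight (d : ℕ) (s : ℝ) (j : Fin d → ℤ) : ℝ := (1 + ‖j‖) ^ s

end Slanted

end

/-! Place row `m` at the lattice point `⌊α m⌋`. Entry `(m, n)` then lies on the slant of index `⌊α
m⌋ - n`, so summable slants give a Schur bound with weight `(1 + |⌊α m⌋ - n|) ^ (d + 1)`; bounded
fibres of `m ↦ ⌊α m⌋` control the columns. Exponent `d + 1` is enough, as it makes the decay kernels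
summable on `ℤ^d`.

The core is `PolySchurBound.exists_enorm_apply_le`. Conjugating `A` by a weight of scale `t` centred
at `k` perturbs it by `O(t)` in Schur norm, so lower boundedness on `ℓ^p` survives for small `t`,
uniformly in `k`. This bounds `‖x k‖` by a convolution-like sum of `‖(A x) m‖` against a summable
kernel, whatever `ℓ^q` contains `x`.

It is used twice. By the Schur test, `A` is bounded below on `ℓ²`, hence the Gram matrix `A* A` is
invertible there. Applied to `A* A`, the estimate gives decay of the entries of the inverse `G` (a
Wiener lemma). The matrix identity `G (A* A) = 1` then acts on every `ℓ^q`, so `G A*` is a left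
inverse of `A` and the range is complemented. -/

noncomputable section

namespace Slanted

open scoped NNReal

/-! ### The Schur test. -/

section Schur

variable {ι : Type*}

/-- The row and column sums of the nonnegative kernel `k` are bounded by `C`. -/
structure SchurBound (k : ι → ι → ℝ≥0∞) (C : ℝ≥0) : Prop where
  row : ∀ m, ∑' n, k m n ≤ C
  col : ∀ n, ∑' m, k m n ≤ C

theorem SchurBound.mono {k k' : ι → ι → ℝ≥0∞} {C : ℝ≥0} (h : SchurBound k C)
    (hk : ∀ m n, k' m n ≤ k m n) : SchurBound k' C :=
  ⟨fun m => (ENNReal.tsum_le_tsum (hk m)).trans (h.row m),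
    fun n => (ENNReal.tsum_le_tsum fun m => hk m n).trans (h.col n)⟩

theorem SchurBound.swap {k : ι → ι → ℝ≥0∞} {C : ℝ≥0} (h : SchurBound k C) :
    SchurBound (fun m n => k n m) C :=
  ⟨h.col, h.row⟩

theorem SchurBound.const_mul {k : ι → ι → ℝ≥0∞} {C : ℝ≥0} (h : SchurBound k C) (c : ℝ≥0) :
    SchurBound (fun m n => c * k m n) (c * C) := by
  refine ⟨fun m => ?_, fun n => ?_⟩ <;> rw [ENNReal.tsum_mul_left, ENNReal.coe_mul]
  · gcongr; exact h.row m
  · gcongr; exact h.col n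

theorem SchurBound.comp {k k' : ι → ι → ℝ≥0∞} {C C' : ℝ≥0} (h : SchurBound k C)
    (h' : SchurBound k' C') : SchurBound (fun m l => ∑' n, k m n * k' n l) (C * C') := by
  refine ⟨fun m => ?_, fun l => ?_⟩ <;> rw [ENNReal.coe_mul]
  · rw [ENNReal.tsum_comm]
    calc ∑' n, ∑' l, k m n * k' n l ≤ ∑' n, k m n * C' := by
          refine ENNReal.tsum_le_tsum fun n => ?_
          rw [ENNReal.tsum_mul_left]
          gcongr
          exact h'.row n
      _ ≤ C * C' := by rw [ENNReal.tsum_mul_right]; gcongr; exact h.row m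
  · rw [ENNReal.tsum_comm]
    calc ∑' n, ∑' m, k m n * k' n l ≤ ∑' n, C * k' n l := by
          refine ENNReal.tsum_le_tsum fun n => ?_
          rw [ENNReal.tsum_mul_right]
          gcongr
          exact h.col n
      _ ≤ C * C' := by rw [ENNReal.tsum_mul_left]; gcongr; exact h'.col l

/-- Hölder's inequality for the measure with weights `w`, passed from finite sums to the supremum.
-/
theorem tsum_mul_rpow_le {p : ℝ} (hp : 1 ≤ p) (w f : ι → ℝ≥0∞) :
    (∑' i, w i * f i) ^ p ≤ (∑' i, w i) ^ (p - 1) * ∑' i, w i * f i ^ p := by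
  have hp0 : 0 < p := by linarith
  have key : ∑' i, w i * f i ≤ (∑' i, w i) ^ (1 - p⁻¹) * (∑' i, w i * f i ^ p) ^ p⁻¹ := by
    rw [ENNReal.tsum_eq_iSup_sum]
    refine iSup_le fun s => (ENNReal.inner_le_weight_mul_Lp_of_nonneg s hp w f).trans ?_
    have h0 : 0 ≤ 1 - p⁻¹ := sub_nonneg.2 (inv_le_one_of_one_le₀ hp)
    gcongr <;> exact ENNReal.sum_le_tsum s
  calc (∑' i, w i * f i) ^ p
      ≤ ((∑' i, w i) ^ (1 - p⁻¹) * (∑' i, w i * f i ^ p) ^ p⁻¹) ^ p := by gcongr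
    _ = _ := by
      rw [ENNReal.mul_rpow_of_nonneg _ _ hp0.le, ← ENNReal.rpow_mul, ← ENNReal.rpow_mul,
        inv_mul_cancel₀ hp0.ne', ENNReal.rpow_one, sub_mul, inv_mul_cancel₀ hp0.ne', one_mul]

/-- The Schur test in `ℓ^p`, `1 ≤ p < ∞`. -/
theorem SchurBound.tsum_rpow_le {k : ι → ι → ℝ≥0∞} {C : ℝ≥0} (h : SchurBound k C) {p : ℝ}
    (hp : 1 ≤ p) (f : ι → ℝ≥0∞) :
    ∑' m, (∑' n, k m n * f n) ^ p ≤ (C : ℝ≥0∞) ^ p * ∑' n, f n ^ p := by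
  have hp0 : 0 ≤ p - 1 := by linarith
  calc ∑' m, (∑' n, k m n * f n) ^ p
      ≤ ∑' m, (C : ℝ≥0∞) ^ (p - 1) * ∑' n, k m n * f n ^ p := by
        refine ENNReal.tsum_le_tsum fun m => (tsum_mul_rpow_le hp _ _).trans ?_
        gcongr
        exact h.row m
    _ = (C : ℝ≥0∞) ^ (p - 1) * ∑' n, (∑' m, k m n) * f n ^ p := by
        rw [ENNReal.tsum_mul_left, ENNReal.tsum_comm]
        simp_rw [ENNReal.tsum_mul_right]
    _ ≤ (C : ℝ≥0∞) ^ (p - 1) * (C * ∑' n, f n ^ p) := by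
        rw [← ENNReal.tsum_mul_left (a := (C : ℝ≥0∞))]
        refine mul_le_mul_right (ENNReal.tsum_le_tsum fun n => ?_) _
        exact mul_le_mul_left (h.col n) _
    _ = (C : ℝ≥0∞) ^ p * ∑' n, f n ^ p := by
        rw [← mul_assoc]
        congr 1
        nth_rewrite 2 [← ENNReal.rpow_one (C : ℝ≥0∞)]
        rw [← ENNReal.rpow_add_of_nonneg _ _ hp0 zero_le_one, sub_add_cancel]

variable {E : Type*} [NormedAddCommGroup E] {p : ℝ≥0∞}

theorem memℓp_of_tsum_enorm_rpow_ne_top {f : ι → E} (h : ∑' i, ‖f i‖ₑ ^ p.toReal ≠ ∞) :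
    Memℓp f p := by
  refine memℓp_gen ?_
  have : Summable fun i => ‖f i‖₊ ^ p.toReal := by
    refine ENNReal.tsum_coe_ne_top_iff_summable.1 ?_
    simpa only [enorm_eq_nnnorm, ENNReal.coe_rpow_of_nonneg _ ENNReal.toReal_nonneg] using h
  simpa using! NNReal.summable_coe.2 this

theorem enorm_rpow_eq_tsum [Fact (1 ≤ p)] (hp : 0 < p.toReal) (f : lp (fun _ : ι => E) p) :
    ‖f‖ₑ ^ p.toReal = ∑' i, ‖f i‖ₑ ^ p.toReal := by
  have h := lp.hasSum_norm hp f
  rw [← ofReal_norm, ENNReal.ofReal_rpow_of_nonneg (norm_nonneg _) hp.le, ← h.tsum_eq,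
    ENNReal.ofReal_tsum_of_nonneg (fun i => by positivity) h.summable]
  simp_rw [← ofReal_norm]
  exact tsum_congr fun i => (ENNReal.ofReal_rpow_of_nonneg (norm_nonneg _) hp.le).symm

theorem enorm_apply_le [Fact (1 ≤ p)] (hp : p ≠ 0) (f : lp (fun _ : ι => E) p) (i : ι) :
    ‖f i‖ₑ ≤ ‖f‖ₑ := by
  rw [← ofReal_norm, ← ofReal_norm]
  exact ENNReal.ofReal_le_ofReal (lp.norm_apply_le_norm hp f i)

/-- The Schur test in `ℓ^p`, `1 ≤ p ≤ ∞`, in terms of a pointwise domination. -/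
theorem SchurBound.exists_lp {F : Type*} [NormedAddCommGroup F] [Fact (1 ≤ p)]
    {k : ι → ι → ℝ≥0∞} {C : ℝ≥0} (h : SchurBound k C) (x : lp (fun _ : ι => E) p) (y : ι → F)
    (hy : ∀ m, ‖y m‖ₑ ≤ ∑' n, k m n * ‖x n‖ₑ) :
    ∃ z : lp (fun _ : ι => F) p, (∀ m, z m = y m) ∧ ‖z‖ ≤ C * ‖x‖ := by
  have hp1 : 1 ≤ p := Fact.out
  have hp0 : p ≠ 0 := (zero_lt_one.trans_le hp1).ne'
  rcases eq_or_ne p ∞ with rfl | hp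
  · have hb : ∀ m, ‖y m‖ ≤ C * ‖x‖ := fun m => by
      have : ‖y m‖ₑ ≤ C * ‖x‖ₑ := calc
        ‖y m‖ₑ ≤ ∑' n, k m n * ‖x‖ₑ := (hy m).trans <|
          ENNReal.tsum_le_tsum fun n => mul_le_mul_right (enorm_apply_le hp0 x n) _
        _ ≤ C * ‖x‖ₑ := by
          rw [ENNReal.tsum_mul_right]
          gcongr
          exact h.row m
      rw [enorm_eq_nnnorm, enorm_eq_nnnorm, ← ENNReal.coe_mul, ENNReal.coe_le_coe] at this
      exact_mod_cast this
    exact ⟨⟨y, memℓp_infty ⟨C * ‖x‖, by rintro _ ⟨m, rfl⟩; exact hb m⟩⟩, fun m => rfl,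
      lp.norm_le_of_forall_le (by positivity) hb⟩
  · have hpr : 1 ≤ p.toReal := by
      simpa using ENNReal.toReal_mono hp hp1
    have hpr0 : 0 < p.toReal := by linarith
    have hs : ∑' m, ‖y m‖ₑ ^ p.toReal ≤ (C * ‖x‖ₑ) ^ p.toReal := by
      rw [ENNReal.mul_rpow_of_nonneg _ _ hpr0.le, enorm_rpow_eq_tsum hpr0]
      refine le_trans ?_ (h.tsum_rpow_le hpr fun n => ‖x n‖ₑ)
      gcongr with m
      exact hy m
    have hmem : Memℓp y p := by
      refine memℓp_of_tsum_enorm_rpow_ne_top (ne_top_of_le_ne_top ?_ hs)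
      exact ENNReal.rpow_ne_top_of_nonneg hpr0.le (ENNReal.mul_ne_top ENNReal.coe_ne_top enorm_ne_top)
    refine ⟨⟨y, hmem⟩, fun m => rfl, ?_⟩
    set z : lp (fun _ : ι => F) p := ⟨y, hmem⟩
    have : ‖z‖ₑ ≤ C * ‖x‖ₑ := by
      rw [← ENNReal.rpow_le_rpow_iff hpr0, enorm_rpow_eq_tsum hpr0]
      exact hs
    rw [enorm_eq_nnnorm, enorm_eq_nnnorm, ← ENNReal.coe_mul, ENNReal.coe_le_coe] at this
    exact_mod_cast this

end Schur

/-! ### Matrices acting on `ℓ^p` and their products. -/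

section Operators

variable {𝕜 : Type*} [RCLike 𝕜] {d : ℕ} {X Y Z : Type*}
  [NormedAddCommGroup X] [NormedSpace 𝕜 X] [NormedAddCommGroup Y] [NormedSpace 𝕜 Y]
  [NormedAddCommGroup Z] [NormedSpace 𝕜 Z]

theorem enorm_clm_apply_le (f : X →L[𝕜] Y) (x : X) : ‖f x‖ₑ ≤ ‖f‖ₑ * ‖x‖ₑ := by
  rw [enorm_eq_nnnorm, enorm_eq_nnnorm, enorm_eq_nnnorm, ← ENNReal.coe_mul, ENNReal.coe_le_coe]
  exact f.le_opNNNorm x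

theorem SchurBound.tsum_enorm_apply_ne_top {M : OpMatrix 𝕜 d X Y} {C : ℝ≥0}
    (h : SchurBound (fun m n => ‖M m n‖ₑ) C) {p : ℝ≥0∞} [Fact (1 ≤ p)] (x : Ell d X p)
    (m : Fin d → ℤ) : ∑' n, ‖M m n‖ₑ * ‖x n‖ₑ ≠ ∞ := by
  have hp0 : p ≠ 0 := (zero_lt_one.trans_le (Fact.out : 1 ≤ p)).ne'
  refine ne_top_of_le_ne_top
    (ENNReal.mul_ne_top (ENNReal.coe_ne_top (r := C)) (enorm_ne_top (x := x))) ?_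
  calc ∑' n, ‖M m n‖ₑ * ‖x n‖ₑ ≤ ∑' n, ‖M m n‖ₑ * ‖x‖ₑ := by
        gcongr
        exact enorm_apply_le hp0 x _
    _ ≤ C * ‖x‖ₑ := by
        rw [ENNReal.tsum_mul_right]
        gcongr
        exact h.row m

theorem SchurBound.summable_apply [CompleteSpace Y] {M : OpMatrix 𝕜 d X Y} {C : ℝ≥0}
    (h : SchurBound (fun m n => ‖M m n‖ₑ) C) {p : ℝ≥0∞} [Fact (1 ≤ p)] (x : Ell d X p)
    (m : Fin d → ℤ) : Summable fun n => M m n (x n) :=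
  Summable.of_enorm <| ne_top_of_le_ne_top (h.tsum_enorm_apply_ne_top x m)
    (ENNReal.tsum_le_tsum fun _ => enorm_clm_apply_le _ _)

/-- A matrix with a Schur bound acts on every `ℓ^p`. -/
theorem SchurBound.exists_isOperatorOf [CompleteSpace Y] {M : OpMatrix 𝕜 d X Y} {C : ℝ≥0}
    (h : SchurBound (fun m n => ‖M m n‖ₑ) C) (p : ℝ≥0∞) [Fact (1 ≤ p)] :
    ∃ T : Ell d X p →L[𝕜] Ell d Y p, IsOperatorOf M T ∧ ‖T‖ ≤ C := by
  have hs := fun x : Ell d X p => h.summable_apply x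
  have hex := fun x : Ell d X p => h.exists_lp x (fun m => ∑' n, M m n (x n)) fun m =>
    (enorm_tsum_le_tsum_enorm (f := fun n => M m n (x n))).trans
      (ENNReal.tsum_le_tsum fun n => enorm_clm_apply_le (M m n) (x n))
  choose T hT hTn using hex
  let L : Ell d X p →ₗ[𝕜] Ell d Y p :=
    { toFun := T
      map_add' := fun x y => by
        ext m
        have e : (T x + T y) m = T x m + T y m := rfl
        have e' : ∀ n, (x + y) n = x n + y n := fun _ => rfl
        simp only [e, hT, e', map_add]
        exact (hs x m).tsum_add (hs y m)
      map_smul' := fun c x => by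
        ext m
        have e : (c • T x) m = c • T x m := rfl
        have e' : ∀ n, (c • x) n = c • x n := fun _ => rfl
        simp only [RingHom.id_apply, e, hT, e', map_smul]
        exact (hs x m).tsum_const_smul c }
  refine ⟨L.mkContinuous C hTn, fun x m => ?_, L.mkContinuous_norm_le C.2 hTn⟩
  have : L.mkContinuous C hTn x m = ∑' n, M m n (x n) := hT x m
  rw [this]
  exact (hs x m).hasSum

/-- The product of two operator matrices. -/
def matMul (M : OpMatrix 𝕜 d Y Z) (N : OpMatrix 𝕜 d X Y) : OpMatrix 𝕜 d X Z :=
  fun m l => ∑' n, (M m n).comp (N n l)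

theorem enorm_comp_le (f : Y →L[𝕜] Z) (g : X →L[𝕜] Y) : ‖f.comp g‖ₑ ≤ ‖f‖ₑ * ‖g‖ₑ := by
  rw [enorm_eq_nnnorm, enorm_eq_nnnorm, enorm_eq_nnnorm, ← ENNReal.coe_mul, ENNReal.coe_le_coe]
  exact f.opNNNorm_comp_le g

theorem enorm_matMul_le (M : OpMatrix 𝕜 d Y Z) (N : OpMatrix 𝕜 d X Y) (m l : Fin d → ℤ) :
    ‖matMul M N m l‖ₑ ≤ ∑' n, ‖M m n‖ₑ * ‖N n l‖ₑ :=
  (enorm_tsum_le_tsum_enorm (f := fun n => (M m n).comp (N n l))).trans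
    (ENNReal.tsum_le_tsum fun _ => enorm_comp_le _ _)

/-- The matrix product corresponds to the composition of operators. -/
theorem IsOperatorOf.comp [CompleteSpace Z] {M : OpMatrix 𝕜 d Y Z} {N : OpMatrix 𝕜 d X Y}
    {C C' : ℝ≥0} (hM : SchurBound (fun m n => ‖M m n‖ₑ) C)
    (hN : SchurBound (fun m n => ‖N m n‖ₑ) C') {p : ℝ≥0∞} [Fact (1 ≤ p)]
    {S : Ell d Y p →L[𝕜] Ell d Z p} {T : Ell d X p →L[𝕜] Ell d Y p} (hS : IsOperatorOf M S)
    (hT : IsOperatorOf N T) : IsOperatorOf (matMul M N) (S.comp T) := by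
  intro x m
  -- Absolute convergence of the double sum justifies the interchange even for `p = ∞`, where
  -- finitely supported vectors are not dense.
  have hfin : ∑' l, ∑' n, ‖M m n‖ₑ * (‖N n l‖ₑ * ‖x l‖ₑ) ≠ ∞ := by
    simp_rw [← mul_assoc, ENNReal.tsum_mul_right]
    have hp0 : p ≠ 0 := (zero_lt_one.trans_le (Fact.out : 1 ≤ p)).ne'
    refine ne_top_of_le_ne_top (ENNReal.mul_ne_top (ENNReal.coe_ne_top (r := C * C'))
      (enorm_ne_top (x := x))) ?_
    calc ∑' l, (∑' n, ‖M m n‖ₑ * ‖N n l‖ₑ) * ‖x l‖ₑ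
        ≤ ∑' l, (∑' n, ‖M m n‖ₑ * ‖N n l‖ₑ) * ‖x‖ₑ := by
          gcongr with l
          exact enorm_apply_le hp0 x l
      _ ≤ ↑(C * C') * ‖x‖ₑ := by
          rw [ENNReal.tsum_mul_right]
          gcongr
          exact (hM.comp hN).row m
  have hle : ∀ l n, ‖M m n (N n l (x l))‖ₑ ≤ ‖M m n‖ₑ * (‖N n l‖ₑ * ‖x l‖ₑ) := fun l n =>
    (enorm_clm_apply_le _ _).trans (by gcongr; exact enorm_clm_apply_le _ _)
  have hsum : Summable fun q : (Fin d → ℤ) × (Fin d → ℤ) => M m q.2 (N q.2 q.1 (x q.1)) := by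
    refine Summable.of_enorm (ne_top_of_le_ne_top hfin ?_)
    rw [ENNReal.tsum_prod']
    gcongr with l n
    exact hle l n
  have hcomp : ∀ l, matMul M N m l (x l) = ∑' n, M m n (N n l (x l)) := fun l => by
    have : Summable fun n => (M m n).comp (N n l) := by
      refine Summable.of_enorm (ne_top_of_le_ne_top
        (ENNReal.coe_ne_top (r := C * C')) ?_)
      calc ∑' n, ‖(M m n).comp (N n l)‖ₑ ≤ ∑' n, ‖M m n‖ₑ * ‖N n l‖ₑ :=
            ENNReal.tsum_le_tsum fun n => enorm_comp_le _ _
        _ ≤ ∑' l, ∑' n, ‖M m n‖ₑ * ‖N n l‖ₑ :=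
            ENNReal.le_tsum (f := fun l => ∑' n, ‖M m n‖ₑ * ‖N n l‖ₑ) l
        _ ≤ _ := (hM.comp hN).row m
    exact ((ContinuousLinearMap.apply 𝕜 Z (x l)).hasSum this.hasSum).tsum_eq.symm
  have hrow : ∀ n, M m n (T x n) = ∑' l, M m n (N n l (x l)) := fun n =>
    ((M m n).hasSum (hT x n)).tsum_eq.symm
  have h1 : HasSum (fun l => ∑' n, M m n (N n l (x l))) (∑' l, ∑' n, M m n (N n l (x l))) :=
    hsum.prod.hasSum
  have h2 : S (T x) m = ∑' l, ∑' n, M m n (N n l (x l)) := by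
    rw [← (hS (T x) m).tsum_eq, tsum_congr hrow]
    exact Summable.tsum_comm (f := fun l n => M m n (N n l (x l))) hsum
  rw [funext hcomp, ContinuousLinearMap.comp_apply, h2]
  exact h1

end Operators

/-! ### Slowly varying polynomial weights. -/

section Weights

/-- Polynomially decaying weight at scale `t`, equal to `1` at the origin. -/
def decay {d : ℕ} (r : ℕ) (t : ℝ) (n : Fin d → ℤ) : ℝ := ((1 + t * ‖n‖) ^ r)⁻¹

theorem decay_pos {d : ℕ} (r : ℕ) {t : ℝ} (ht : 0 ≤ t) (n : Fin d → ℤ) : 0 < decay r t n := by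
  unfold decay
  positivity

/-- Convexity of the power: `1 + t u` is the convex combination of `1` and `1 + u` with parameter
`t`. -/
theorem one_add_mul_pow_sub_one_le (r : ℕ) {t u : ℝ} (ht : 0 ≤ t) (ht1 : t ≤ 1) (hu : 0 ≤ u) :
    (1 + t * u) ^ r - 1 ≤ t * (1 + u) ^ r := by
  have h := (convexOn_pow (𝕜 := ℝ) r).2 (x := 1) (y := 1 + u) (by simp)
    (by simp only [Set.mem_Ici]; linarith) (sub_nonneg.2 ht1) ht (by ring)
  simp only [smul_eq_mul, one_pow, mul_one] at h
  have e : 1 - t + t * (1 + u) = 1 + t * u := by ring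
  rw [e] at h
  linarith

theorem abs_pow_div_pow_sub_one_le (r : ℕ) {a b v : ℝ} (ha : 0 < a) (hb : 0 < b)
    (hab : a ≤ v * b) (hba : b ≤ v * a) : |a ^ r / b ^ r - 1| ≤ v ^ r - 1 := by
  have h1 : a ^ r / b ^ r ≤ v ^ r := by
    rw [← div_pow]
    exact pow_le_pow_left₀ (by positivity) ((div_le_iff₀ hb).2 hab) r
  have h2 : (a ^ r / b ^ r)⁻¹ ≤ v ^ r := by
    rw [inv_div, ← div_pow]
    exact pow_le_pow_left₀ (by positivity) ((div_le_iff₀ ha).2 hba) r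
  have h3 : 0 < a ^ r / b ^ r := by positivity
  set y := a ^ r / b ^ r
  -- By AM-GM, `1 - y ≤ y⁻¹ - 1`, so the bound on `y⁻¹` also controls the lower deviation.
  have h4 : 2 - y ≤ y⁻¹ := by
    have e : y + y⁻¹ - 2 = (y - 1) ^ 2 * y⁻¹ := by field_simp; ring
    have : 0 ≤ (y - 1) ^ 2 * y⁻¹ := by positivity
    linarith
  rw [abs_le]
  constructor <;> linarith

/-- The factor `t`, uniform in the centre `k`, is what makes conjugation by the weight a small
perturbation. -/
theorem abs_decay_div_decay_sub_one_le {d : ℕ} (r : ℕ) {t : ℝ} (ht : 0 ≤ t) (ht1 : t ≤ 1)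
    (k l n : Fin d → ℤ) :
    |decay r t (l - k) / decay r t (n - k) - 1| ≤ t * (1 + ‖l - n‖) ^ r := by
  have tri : ∀ a b : Fin d → ℤ, 1 + t * ‖a - k‖ ≤ (1 + t * ‖a - b‖) * (1 + t * ‖b - k‖) := by
    intro a b
    have h := mul_le_mul_of_nonneg_left (norm_sub_le_norm_sub_add_norm_sub a b k) ht
    have h' : 0 ≤ t * ‖a - b‖ * (t * ‖b - k‖) := by positivity
    nlinarith
  unfold decay
  rw [inv_div_inv]
  refine (abs_pow_div_pow_sub_one_le r (v := 1 + t * ‖l - n‖) (by positivity) (by positivity)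
    ?_ (tri l n)).trans (one_add_mul_pow_sub_one_le r ht ht1 (norm_nonneg _))
  rw [norm_sub_rev l n]
  exact tri n l

theorem summable_decay (d : ℕ) {t : ℝ} (ht : 0 < t) :
    Summable fun n : Fin d → ℤ => decay (d + 1) t n := by
  let φ : (Fin d → ℤ) →ₗ[ℤ] (Fin d → ℝ) :=
    { toFun := fun n i => n i
      map_add' := fun a b => by ext i; simp
      map_smul' := fun a b => by ext i; simp }
  have hφ : ∀ n, ‖φ n‖ = ‖n‖ := fun n => by
    simp only [Pi.norm_def]
    rfl
  have hiso : Isometry φ := AddMonoidHomClass.isometry_of_norm φ hφ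
  have hdisc : DiscreteTopology (LinearMap.range φ) := by
    have : DiscreteTopology (Set.range φ) :=
      (hiso.isEmbedding.toHomeomorph).symm.isEmbedding.discreteTopology
    exact this
  have hfin : Module.finrank ℤ (LinearMap.range φ) < d + 1 := by
    have := LinearMap.finrank_range_le φ
    simp only [Module.finrank_fin_fun] at this
    omega
  have hs := ZLattice.summable_norm_pow_inv (LinearMap.range φ) (d + 1) hfin
  have hs' : Summable fun n : Fin d → ℤ => ‖n‖⁻¹ ^ (d + 1) := by
    refine ((LinearEquiv.ofInjective φ hiso.injective).toEquiv.summable_iff.2 hs).congr fun n => ?_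
    rw [← hφ n]
    rfl
  -- The comparison fails at the origin, where the inverse norm is `0` by convention, so it is made
  -- off a finite set.
  refine Summable.of_norm_bounded_eventually (hs'.mul_left (t⁻¹ ^ (d + 1))) ?_
  filter_upwards [(Set.finite_singleton (0 : Fin d → ℤ)).compl_mem_cofinite] with n hn
  have hn0 : 0 < ‖n‖ := norm_pos_iff.2 hn
  rw [Real.norm_of_nonneg (decay_pos _ ht.le n).le, decay, ← mul_pow, ← mul_inv, inv_pow]
  gcongr
  linarith

end Weights

/-! ### Independence of lower boundedness from the exponent. -/

section Stability

variable {𝕜 : Type*} [RCLike 𝕜] {d : ℕ} {X Y : Type*}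
  [NormedAddCommGroup X] [NormedSpace 𝕜 X] [NormedAddCommGroup Y] [NormedSpace 𝕜 Y]

theorem enorm_lp_le_tsum_enorm {ι E : Type*} [DecidableEq ι] [NormedAddCommGroup E] {p : ℝ≥0∞}
    [Fact (1 ≤ p)] (v : lp (fun _ : ι => E) p) : ‖v‖ₑ ≤ ∑' i, ‖v i‖ₑ := by
  have hp0 : 0 < p := zero_lt_one.trans_le (Fact.out : 1 ≤ p)
  rcases eq_or_ne p ∞ with rfl | hp
  · by_cases h : ∑' i, ‖v i‖ₑ = ∞
    · simp [h]
    · rw [← ofReal_norm]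
      refine ENNReal.ofReal_le_of_le_toReal
        (lp.norm_le_of_forall_le ENNReal.toReal_nonneg fun i => ?_)
      rw [← toReal_enorm]
      exact ENNReal.toReal_mono h (ENNReal.le_tsum i)
  · conv_lhs => rw [← (lp.hasSum_single hp v).tsum_eq]
    refine enorm_tsum_le_tsum_enorm.trans (ENNReal.tsum_le_tsum fun i => ?_)
    rw [← ofReal_norm, lp.norm_single hp0, ofReal_norm]

/-- The matrix `A` has polynomially weighted Schur bound `C`, where the row `m` is placed at the
lattice point `ρ m` and the column `n` at `σ n`. -/
def PolySchurBound (r : ℕ) (ρ σ : (Fin d → ℤ) → Fin d → ℤ) (A : OpMatrix 𝕜 d X Y) (C : ℝ≥0) :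
    Prop :=
  SchurBound (fun m n => ‖A m n‖ₑ * ENNReal.ofReal ((1 + ‖ρ m - σ n‖) ^ r)) C

theorem one_le_ofReal_one_add_norm_pow (r : ℕ) (v : Fin d → ℤ) :
    1 ≤ ENNReal.ofReal ((1 + ‖v‖) ^ r) := by
  rw [← ENNReal.ofReal_one]
  exact ENNReal.ofReal_le_ofReal (one_le_pow₀ (by linarith [norm_nonneg v]))

theorem PolySchurBound.schurBound {r : ℕ} {ρ σ : (Fin d → ℤ) → Fin d → ℤ} {A : OpMatrix 𝕜 d X Y}
    {C : ℝ≥0} (h : PolySchurBound r ρ σ A C) : SchurBound (fun m n => ‖A m n‖ₑ) C :=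
  SchurBound.mono h fun _ _ => le_mul_of_one_le_right' (one_le_ofReal_one_add_norm_pow _ _)

/-- A matrix that is bounded below on some `ℓ^p` dominates, pointwise and up to a summable
polynomial weight, every bounded vector by its image. -/
theorem PolySchurBound.exists_enorm_apply_le [CompleteSpace Y] {ρ : (Fin d → ℤ) → Fin d → ℤ}
    {A : OpMatrix 𝕜 d X Y} {C : ℝ≥0} (hC : PolySchurBound (d + 1) ρ id A C) {p : ℝ≥0∞}
    [Fact (1 ≤ p)] (hA : IsBoundedBelow A p) :
    ∃ t : ℝ, 0 < t ∧ ∃ c : ℝ≥0, ∀ {q : ℝ≥0∞} [Fact (1 ≤ q)] (x : Ell d X q)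
      (y : (Fin d → ℤ) → Y), (∀ m, HasSum (fun n => A m n (x n)) (y m)) → ∀ k,
        ‖x k‖ₑ ≤ ∑' m, c * ENNReal.ofReal (decay (d + 1) t (ρ m - k)) * ‖y m‖ₑ := by
  obtain ⟨T, hT, κ, hκ, hTκ⟩ := hA
  -- The scale makes the perturbation cost at most half of `κ`; the `+ 1` covers `C = 0`.
  obtain ⟨t, ht, ht1, htC⟩ : ∃ t : ℝ, 0 < t ∧ t ≤ 1 ∧ t * C ≤ κ / 2 := by
    refine ⟨min 1 (κ / (2 * (C + 1))), by positivity, min_le_left _ _, ?_⟩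
    calc min 1 (κ / (2 * (C + 1))) * C ≤ κ / (2 * (C + 1)) * (C + 1) := by
          gcongr
          · exact min_le_right _ _
          · linarith
      _ = κ / 2 := by field_simp
  refine ⟨t, ht, (2 / κ).toNNReal, fun {q} _ x y hy k => ?_⟩
  set w : (Fin d → ℤ) → ℝ := fun n => decay (d + 1) t (n - k) with hw
  have hwpos : ∀ n, 0 < w n := fun n => decay_pos _ ht.le _
  have hws : Summable w :=
    (Equiv.subRight k).summable_iff.2 (summable_decay d ht)
  have hq0 : q ≠ 0 := (zero_lt_one.trans_le (Fact.out : 1 ≤ q)).ne'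
  -- Passage from `ℓ^q` to `ℓ^p`: `x` is bounded and `w` summable, so `w x` lies in `ℓ¹`.
  have hz : Memℓp (fun n => (w n : 𝕜) • x n) p := by
    refine Memℓp.of_exponent_ge (q := 1) (memℓp_gen ?_) Fact.out
    simp only [ENNReal.toReal_one, Real.rpow_one]
    refine Summable.of_nonneg_of_le (fun n => norm_nonneg _) (fun n => ?_) (hws.mul_right ‖x‖)
    rw [norm_smul, RCLike.norm_ofReal, abs_of_pos (hwpos n)]
    exact mul_le_mul_of_nonneg_left (lp.norm_apply_le_norm hq0 x n) (hwpos n).le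
  let z : Ell d X p := ⟨_, hz⟩
  have hzn : ∀ n, z n = (w n : 𝕜) • x n := fun _ => rfl
  -- `D = w A w⁻¹ - A`, with `w` evaluated at `ρ m` on the rows; hence `(A + D) z = w y` for `z = w
  -- x`.
  let D : OpMatrix 𝕜 d X Y := fun m n => ((w (ρ m) / w n - 1 : ℝ) : 𝕜) • A m n
  have hD : SchurBound (fun m n => ‖D m n‖ₑ) (t.toNNReal * C) := by
    refine (SchurBound.const_mul hC t.toNNReal).mono fun m n => ?_
    have h1 : ‖((w (ρ m) / w n - 1 : ℝ) : 𝕜)‖ₑ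
        ≤ t.toNNReal * ENNReal.ofReal ((1 + ‖ρ m - n‖) ^ (d + 1)) := by
      rw [← ofReal_norm, RCLike.norm_ofReal]
      change _ ≤ ENNReal.ofReal t * _
      rw [← ENNReal.ofReal_mul ht.le]
      exact ENNReal.ofReal_le_ofReal (abs_decay_div_decay_sub_one_le _ ht.le ht1 k (ρ m) n)
    calc ‖D m n‖ₑ = ‖((w (ρ m) / w n - 1 : ℝ) : 𝕜)‖ₑ * ‖A m n‖ₑ := enorm_smul _ _
      _ ≤ t.toNNReal * ENNReal.ofReal ((1 + ‖ρ m - n‖) ^ (d + 1)) * ‖A m n‖ₑ := by gcongr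
      _ = _ := by rw [id]; ring
  obtain ⟨Dp, hDp, hDn⟩ := hD.exists_isOperatorOf p
  have hv : ∀ m, (T z + Dp z) m = (w (ρ m) : 𝕜) • y m := fun m => by
    have h1 := (hT z m).add (hDp z m)
    refine h1.unique ?_
    convert (hy m).const_smul (w (ρ m) : 𝕜) using 1
    ext n
    have hne : (w n : 𝕜) ≠ 0 := by exact_mod_cast (hwpos n).ne'
    simp only [D, hzn, smul_apply, map_smul, smul_smul, ← add_smul]
    congr 1
    push_cast
    field_simp
    ring
  have hnorm : ‖z‖ ≤ 2 / κ * ‖T z + Dp z‖ := by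
    have h1 : ‖Dp z‖ ≤ κ / 2 * ‖z‖ := (Dp.le_of_opNorm_le hDn z).trans <| by
      gcongr
      rwa [NNReal.coe_mul, Real.coe_toNNReal _ ht.le]
    have h2 := norm_le_add_norm_add (T z) (Dp z)
    have h3 := hTκ z
    rw [div_mul_eq_mul_div, le_div_iff₀ hκ]
    linarith
  have hp0 : p ≠ 0 := (zero_lt_one.trans_le (Fact.out : 1 ≤ p)).ne'
  have hzk : z k = x k := by
    simp [hzn, hw, decay]
  calc ‖x k‖ₑ ≤ ‖z‖ₑ := hzk ▸ enorm_apply_le hp0 z k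
    _ ≤ ENNReal.ofReal (2 / κ) * ‖T z + Dp z‖ₑ := by
      rw [← ofReal_norm, ← ofReal_norm, ← ENNReal.ofReal_mul (by positivity)]
      exact ENNReal.ofReal_le_ofReal hnorm
    _ ≤ ENNReal.ofReal (2 / κ) * ∑' m, ‖(T z + Dp z) m‖ₑ := by
      gcongr
      exact enorm_lp_le_tsum_enorm _
    _ = ∑' m, (2 / κ).toNNReal * ENNReal.ofReal (w (ρ m)) * ‖y m‖ₑ := by
      rw [← ENNReal.tsum_mul_left]
      refine tsum_congr fun m => ?_
      rw [hv m, enorm_smul, ← mul_assoc]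
      congr 2
      rw [← ofReal_norm, RCLike.norm_ofReal, abs_of_pos (hwpos _)]

theorem tsum_ofReal_decay_ne_top (d : ℕ) {t : ℝ} (ht : 0 < t) :
    ∑' n : Fin d → ℤ, ENNReal.ofReal (decay (d + 1) t n) ≠ ∞ := by
  rw [← ENNReal.ofReal_tsum_of_nonneg (fun n => (decay_pos _ ht.le n).le) (summable_decay d ht)]
  exact ENNReal.ofReal_ne_top

/-- The map `ρ` has uniformly bounded fibres. -/
def BoundedFibres (ρ : (Fin d → ℤ) → Fin d → ℤ) (N : ℝ≥0) : Prop :=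
  ∀ f : (Fin d → ℤ) → ℝ≥0∞, ∑' m, f (ρ m) ≤ N * ∑' n, f n

theorem exists_schurBound_decay {ρ : (Fin d → ℤ) → Fin d → ℤ} {N : ℝ≥0} (hρ : BoundedFibres ρ N)
    {t : ℝ} (ht : 0 < t) (c : ℝ≥0) :
    ∃ C, SchurBound (fun k m => c * ENNReal.ofReal (decay (d + 1) t (ρ m - k))) C := by
  obtain ⟨S, hS⟩ : ∃ S : ℝ≥0, (S : ℝ≥0∞) = _ :=
    ⟨_, ENNReal.coe_toNNReal (tsum_ofReal_decay_ne_top d ht)⟩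
  -- Rows cost `N * S` by the fibre bound and columns cost `S`; `N + 1` dominates both factors.
  refine ⟨c * ((N + 1) * S), SchurBound.const_mul ⟨fun k => ?_, fun m => ?_⟩ c⟩ <;> push_cast
  · refine (hρ fun n => ENNReal.ofReal (decay (d + 1) t (n - k))).trans ?_
    have := (Equiv.subRight k).tsum_eq fun n => ENNReal.ofReal (decay (d + 1) t n)
    simp only [Equiv.subRight_apply] at this
    rw [this, ← hS]
    gcongr
    exact le_self_add
  · have := (Equiv.subLeft (ρ m)).tsum_eq fun n => ENNReal.ofReal (decay (d + 1) t n)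
    simp only [Equiv.subLeft_apply] at this
    rw [this, ← hS]
    exact le_mul_of_one_le_left' le_add_self

/-- Boundedness below does not depend on the exponent. -/
theorem PolySchurBound.isBoundedBelow [CompleteSpace Y] {ρ : (Fin d → ℤ) → Fin d → ℤ} {N : ℝ≥0}
    (hρ : BoundedFibres ρ N) {A : OpMatrix 𝕜 d X Y} {C : ℝ≥0}
    (hC : PolySchurBound (d + 1) ρ id A C) {p : ℝ≥0∞} [Fact (1 ≤ p)] (hA : IsBoundedBelow A p)
    (q : ℝ≥0∞) [Fact (1 ≤ q)] : IsBoundedBelow A q := by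
  obtain ⟨t, ht, c, hc⟩ := hC.exists_enorm_apply_le hA
  obtain ⟨T, hT, -⟩ := hC.schurBound.exists_isOperatorOf q
  obtain ⟨K, hK⟩ := exists_schurBound_decay hρ ht c
  refine ⟨T, hT, (K + 1)⁻¹, by positivity, fun x => ?_⟩
  obtain ⟨z, hz, hzn⟩ := hK.exists_lp (T x) x (hc x (T x) (hT x))
  have hzx : z = x := by
    ext m
    exact hz m
  rw [inv_mul_le_iff₀ (by positivity), ← hzx]
  refine hzn.trans ?_
  rw [hzx]
  gcongr
  linarith

end Stability

/-! ### Inverting the Gram matrix and the left inverse. -/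

section LeftInverse

section Matrices

variable {𝕜 : Type*} [RCLike 𝕜] {d : ℕ} {X Y Z : Type*}
  [NormedAddCommGroup X] [NormedSpace 𝕜 X] [NormedAddCommGroup Y] [NormedSpace 𝕜 Y]
  [NormedAddCommGroup Z] [NormedSpace 𝕜 Z]

/-- The weight is submultiplicative along `ρ m`, `σ n`, `τ l`, by the triangle inequality. -/
theorem PolySchurBound.matMul {r : ℕ} {ρ σ τ : (Fin d → ℤ) → Fin d → ℤ} {M : OpMatrix 𝕜 d Y Z}
    {N : OpMatrix 𝕜 d X Y} {C C' : ℝ≥0} (hM : PolySchurBound r ρ σ M C)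
    (hN : PolySchurBound r σ τ N C') : PolySchurBound r ρ τ (matMul M N) (C * C') := by
  refine (SchurBound.comp hM hN).mono fun m l => ?_
  calc ‖Slanted.matMul M N m l‖ₑ * ENNReal.ofReal ((1 + ‖ρ m - τ l‖) ^ r)
      ≤ (∑' n, ‖M m n‖ₑ * ‖N n l‖ₑ) * ENNReal.ofReal ((1 + ‖ρ m - τ l‖) ^ r) := by
        gcongr
        exact enorm_matMul_le M N m l
    _ = ∑' n, ‖M m n‖ₑ * ‖N n l‖ₑ * ENNReal.ofReal ((1 + ‖ρ m - τ l‖) ^ r) :=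
        ENNReal.tsum_mul_right.symm
    _ ≤ _ := by
        refine ENNReal.tsum_le_tsum fun n => ?_
        rw [mul_mul_mul_comm, ← ENNReal.ofReal_mul (by positivity), ← mul_pow]
        gcongr
        nlinarith [norm_sub_le_norm_sub_add_norm_sub (ρ m) (σ n) (τ l), norm_nonneg (ρ m - σ n),
          norm_nonneg (σ n - τ l), mul_nonneg (norm_nonneg (ρ m - σ n)) (norm_nonneg (σ n - τ l))]

theorem ell_single_apply_self (p : ℝ≥0∞) (n : Fin d → ℤ) (h : X) :
    (lp.single p n h : Ell d X p) n = h :=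
  lp.single_apply_self (E := fun _ => X) p n h

theorem ell_single_apply_ne (p : ℝ≥0∞) {m n : Fin d → ℤ} (h : X) (hmn : m ≠ n) :
    (lp.single p n h : Ell d X p) m = 0 :=
  lp.single_apply_ne (E := fun _ => X) p n h hmn

theorem IsOperatorOf.apply_single {p : ℝ≥0∞} [Fact (1 ≤ p)] {A : OpMatrix 𝕜 d X Y}
    {T : Ell d X p →L[𝕜] Ell d Y p} (hT : IsOperatorOf A T) (m n : Fin d → ℤ) (h : X) :
    T (lp.single p n h) m = A m n h := by
  refine (hT _ m).unique ?_
  convert hasSum_single (f := fun n' => A m n' ((lp.single p n h : Ell d X p) n')) n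
    fun n' hn' => ?_ using 1
  · rw [ell_single_apply_self]
  · rw [ell_single_apply_ne p h hn', map_zero]

/-- An operator determines its matrix. -/
theorem IsOperatorOf.matrix_unique {p : ℝ≥0∞} [Fact (1 ≤ p)] {A B : OpMatrix 𝕜 d X Y}
    {T : Ell d X p →L[𝕜] Ell d Y p} (hA : IsOperatorOf A T) (hB : IsOperatorOf B T) : A = B := by
  ext m n h
  rw [← hA.apply_single, hB.apply_single]

/-- The identity matrix. -/
def idMat (𝕜 : Type*) [RCLike 𝕜] (d : ℕ) (X : Type*) [NormedAddCommGroup X] [NormedSpace 𝕜 X] :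
    OpMatrix 𝕜 d X X :=
  fun m n => if n = m then ContinuousLinearMap.id 𝕜 X else 0

theorem isOperatorOf_idMat (p : ℝ≥0∞) [Fact (1 ≤ p)] :
    IsOperatorOf (idMat 𝕜 d X) (ContinuousLinearMap.id 𝕜 (Ell d X p)) := by
  intro x m
  convert hasSum_single (f := fun n => idMat 𝕜 d X m n (x n)) m fun n hn => ?_ using 1
  · simp [idMat]
  · simp [idMat, hn]

/-- The matrix of a bounded operator. -/
def matrixOf {p : ℝ≥0∞} [Fact (1 ≤ p)] (T : Ell d X p →L[𝕜] Ell d Y p) : OpMatrix 𝕜 d X Y :=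
  fun m n => (lp.evalCLM 𝕜 (fun _ => Y) p m).comp
    (T.comp (lp.singleContinuousLinearMap 𝕜 (fun _ => X) p n))

theorem isOperatorOf_matrixOf {p : ℝ≥0∞} [Fact (1 ≤ p)] (hp : p ≠ ∞)
    (T : Ell d X p →L[𝕜] Ell d Y p) : IsOperatorOf (matrixOf T) T := fun x m =>
  ((lp.evalCLM 𝕜 (fun _ => Y) p m).comp T).hasSum (lp.hasSum_single hp x)

end Matrices

variable {𝕜 : Type*} [RCLike 𝕜] {d : ℕ} {X Y : Type*}
  [NormedAddCommGroup X] [InnerProductSpace 𝕜 X] [CompleteSpace X]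
  [NormedAddCommGroup Y] [InnerProductSpace 𝕜 Y] [CompleteSpace Y]

/-- The conjugate transpose of an operator matrix. -/
def adjointMat (A : OpMatrix 𝕜 d X Y) : OpMatrix 𝕜 d Y X :=
  fun n m => ContinuousLinearMap.adjoint (A m n)

theorem PolySchurBound.adjointMat {r : ℕ} {ρ σ : (Fin d → ℤ) → Fin d → ℤ} {A : OpMatrix 𝕜 d X Y}
    {C : ℝ≥0} (hA : PolySchurBound r ρ σ A C) : PolySchurBound r σ ρ (adjointMat A) C := by
  refine (SchurBound.swap hA).mono fun n m => ?_
  rw [Slanted.adjointMat, ← ofReal_norm, LinearIsometryEquiv.norm_map, ofReal_norm, norm_sub_rev]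

theorem IsOperatorOf.adjoint {A : OpMatrix 𝕜 d X Y} {T : Ell d X 2 →L[𝕜] Ell d Y 2}
    (hT : IsOperatorOf A T) {S : Ell d Y 2 →L[𝕜] Ell d X 2} (hS : IsOperatorOf (adjointMat A) S) :
    S = ContinuousLinearMap.adjoint T := by
  ext y n
  refine ext_inner_right 𝕜 fun h => ?_
  rw [← lp.inner_single_right n h (ContinuousLinearMap.adjoint T y),
    ContinuousLinearMap.adjoint_inner_left]
  have h1 := lp.hasSum_inner (𝕜 := 𝕜) y (T (lp.single 2 n h))
  have h2 : HasSum (fun m => inner 𝕜 (adjointMat A n m (y m)) h) (inner 𝕜 (S y n) h) := by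
    simpa using! ((hS y n).mapL ((innerSLFlip 𝕜) h))
  refine h2.unique ?_
  convert h1 using 2 with m
  rw [hT.apply_single, adjointMat, ContinuousLinearMap.adjoint_inner_left]

/-- The Gram matrix of an operator matrix that is bounded below on `ℓ²` has an inverse whose
matrix has a Schur bound. -/
theorem PolySchurBound.exists_gram_inverse {ρ : (Fin d → ℤ) → Fin d → ℤ}
    {A : OpMatrix 𝕜 d X Y} {C : ℝ≥0} (hC : PolySchurBound (d + 1) ρ id A C)
    (hA : IsBoundedBelow A 2) :
    ∃ (G : OpMatrix 𝕜 d X X) (K : ℝ≥0), SchurBound (fun m n => ‖G m n‖ₑ) K ∧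
      Slanted.matMul G (Slanted.matMul (Slanted.adjointMat A) A) = idMat 𝕜 d X := by
  have hC' := hC.adjointMat
  have hB := hC'.matMul hC
  obtain ⟨T, hT, κ, hκ, hTκ⟩ := hA
  obtain ⟨S, hS, -⟩ := hC'.schurBound.exists_isOperatorOf 2
  have hST : IsOperatorOf (Slanted.matMul (Slanted.adjointMat A) A) (S.comp T) :=
    IsOperatorOf.comp hC'.schurBound hC.schurBound hS hT
  -- Coercivity: `⟪T* T x, x⟫ = ‖T x‖ ^ 2 ≥ κ ^ 2 ‖x‖ ^ 2`, so Lax–Milgram applies.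
  have hcoer : ∀ x, ‖x‖ ^ 2 * (κ ^ 2).toNNReal ≤ ‖inner 𝕜 (S.comp T x) x‖ := fun x => by
    rw [Real.coe_toNNReal _ (by positivity), ContinuousLinearMap.comp_apply, hT.adjoint hS,
      ContinuousLinearMap.adjoint_inner_left, inner_self_eq_norm_sq_to_K, norm_pow,
      RCLike.norm_ofReal, abs_norm, ← mul_pow, mul_comm]
    exact pow_le_pow_left₀ (by positivity) (hTκ x) 2
  obtain ⟨u, hu⟩ := ContinuousLinearMap.isUnit_of_forall_le_norm_inner_map (S.comp T)
    (Real.toNNReal_pos.2 (by positivity)) hcoer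
  set E : Ell d X 2 →L[𝕜] Ell d X 2 := ↑u⁻¹
  have hEB : E.comp (S.comp T) = ContinuousLinearMap.id 𝕜 _ := by
    rw [← hu]
    exact u.inv_mul
  have hBE : ∀ x, S.comp T (E x) = x := fun x => by
    rw [← hu]
    exact DFunLike.congr_fun u.mul_inv x
  have hbb : IsBoundedBelow (Slanted.matMul (Slanted.adjointMat A) A) 2 := by
    refine ⟨_, hST, (‖E‖ + 1)⁻¹, by positivity, fun x => ?_⟩
    rw [inv_mul_le_iff₀ (by positivity)]
    calc ‖x‖ = ‖E (S.comp T x)‖ := by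
          rw [show E (S.comp T x) = x from DFunLike.congr_fun hEB x]
      _ ≤ ‖E‖ * ‖S.comp T x‖ := E.le_opNorm _
      _ ≤ (‖E‖ + 1) * ‖S.comp T x‖ := by gcongr; linarith
  obtain ⟨t, ht, c, hc⟩ := hB.exists_enorm_apply_le hbb
  obtain ⟨K, hK⟩ := exists_schurBound_decay (ρ := id) (N := 1) (fun f => by simp) ht c
  have hE : SchurBound (fun m n => ‖matrixOf E m n‖ₑ) K := by
    refine hK.mono fun k n => ?_
    have hle : ∀ h, ‖matrixOf E k n h‖ₑ
        ≤ c * ENNReal.ofReal (decay (d + 1) t (id n - k)) * ‖h‖ₑ := fun h => by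
      -- The vector `E (e_n h)` has image `e_n h` under the Gram matrix, so only the term at `n`
      -- survives in the pointwise estimate.
      have h1 := hc (E (lp.single 2 n h)) (lp.single 2 n h)
        (fun m => by simpa only [hBE] using hST (E (lp.single 2 n h)) m) k
      refine h1.trans_eq ?_
      rw [tsum_eq_single n fun m hm => by rw [ell_single_apply_ne 2 h hm]; simp,
        ell_single_apply_self]
    have hd := (decay_pos (d + 1) ht.le (id n - k)).le
    rw [← ofReal_norm, ← ENNReal.ofReal_coe_nnreal, ← ENNReal.ofReal_mul c.coe_nonneg]
    refine ENNReal.ofReal_le_ofReal (ContinuousLinearMap.opNorm_le_bound _ (by positivity) ?_)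
    intro h
    have := hle h
    rwa [← ofReal_norm, ← ofReal_norm, ← ENNReal.ofReal_coe_nnreal, ← ENNReal.ofReal_mul c.coe_nonneg,
      ← ENNReal.ofReal_mul (by positivity), ENNReal.ofReal_le_ofReal_iff (by positivity)] at this
  refine ⟨matrixOf E, K, hE, ?_⟩
  have h1 := IsOperatorOf.comp hE hB.schurBound (isOperatorOf_matrixOf (by simp) E) hST
  rw [hEB] at h1
  exact h1.matrix_unique (isOperatorOf_idMat 2)

/-- The left inverse is `G A*`: the identity of matrices, found on `ℓ²`, transfers to `ℓ^q` because
all factors have Schur bounds. -/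
theorem PolySchurBound.exists_hasLeftInverse {ρ : (Fin d → ℤ) → Fin d → ℤ}
    {A : OpMatrix 𝕜 d X Y} {C : ℝ≥0} (hC : PolySchurBound (d + 1) ρ id A C)
    (hA : IsBoundedBelow A 2) (q : ℝ≥0∞) [Fact (1 ≤ q)] :
    ∃ T : Ell d X q →L[𝕜] Ell d Y q, IsOperatorOf A T ∧ T.HasLeftInverse := by
  obtain ⟨G, K, hG, hGA⟩ := hC.exists_gram_inverse hA
  have hC' := hC.adjointMat
  obtain ⟨T, hT, -⟩ := hC.schurBound.exists_isOperatorOf q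
  obtain ⟨S, hS, -⟩ := hC'.schurBound.exists_isOperatorOf q
  obtain ⟨E, hE, -⟩ := hG.exists_isOperatorOf q
  have h1 := IsOperatorOf.comp hG (hC'.matMul hC).schurBound hE
    (IsOperatorOf.comp hC'.schurBound hC.schurBound hS hT)
  rw [hGA] at h1
  exact ⟨T, hT, E.comp S, DFunLike.congr_fun (h1.unique (isOperatorOf_idMat q))⟩

end LeftInverse

/-! ### From summable slants to a weighted Schur bound. -/

section Slants

variable {d : ℕ}

/-- The lattice point below `α m`. -/
def slantPos (α : ℝ) (m : Fin d → ℤ) : Fin d → ℤ := fun k => ⌊α * m k⌋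

/-- Points of one fibre differ by less than `|α⁻¹| ≤ K` in each coordinate, so their residues mod
`K` separate them: a fibre has at most `K ^ d` points. -/
theorem boundedFibres_slantPos {α : ℝ} (hα : α ≠ 0) :
    ∃ N, BoundedFibres (slantPos (d := d) α) N := by
  have hK : 0 < ⌈|α⁻¹|⌉₊ := Nat.ceil_pos.2 (by positivity)
  set K := ⌈|α⁻¹|⌉₊ with hKdef
  have : NeZero K := ⟨hK.ne'⟩
  let c : (Fin d → ℤ) → (Fin d → ℤ) × (Fin d → ZMod K) := fun m =>
    (slantPos α m, fun k => (m k : ZMod K))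
  have hinj : Function.Injective c := by
    intro m m' h
    ext k
    have h1 : ⌊α * m k⌋ = ⌊α * m' k⌋ := congrFun (congrArg Prod.fst h) k
    have h2 : (m k : ZMod K) = (m' k : ZMod K) := congrFun (congrArg Prod.snd h) k
    have h3 : |α * (m k - m' k)| < 1 := by
      rw [mul_sub]
      exact Int.abs_sub_lt_one_of_floor_eq_floor h1
    have h4 : |((m k - m' k : ℤ) : ℝ)| < K := by
      push_cast
      refine lt_of_lt_of_le ?_ (Nat.le_ceil _)
      rw [abs_mul] at h3
      rw [abs_inv, ← one_div, lt_div_iff₀ (abs_pos.2 hα), mul_comm]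
      exact h3
    have h5 : |m k - m' k| < K := by exact_mod_cast h4
    have h6 : (K : ℤ) ∣ m k - m' k := by
      rw [← ZMod.intCast_zmod_eq_zero_iff_dvd]
      push_cast
      rw [h2, sub_self]
    have := Int.eq_zero_of_abs_lt_dvd h6 h5
    omega
  refine ⟨(K ^ d : ℕ), fun f => ?_⟩
  calc ∑' m, f (slantPos α m) ≤ ∑' q : (Fin d → ℤ) × (Fin d → ZMod K), f q.1 :=
        ENNReal.tsum_comp_le_tsum_of_injective hinj fun q => f q.1
    _ = _ := by
      rw [ENNReal.tsum_prod', ← ENNReal.tsum_mul_left]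
      simp [tsum_fintype]

variable {𝕜 : Type*} [RCLike 𝕜] {X Y : Type*}
  [NormedAddCommGroup X] [NormedSpace 𝕜 X] [NormedAddCommGroup Y] [NormedSpace 𝕜 Y]

theorem enorm_le_supNorm_slant (α : ℝ) (A : OpMatrix 𝕜 d X Y) (m n : Fin d → ℤ) :
    ‖A m n‖ₑ ≤ supNorm (slant α A (slantPos α m - n)) := by
  have h : slant α A (slantPos α m - n) m n = A m n := by
    refine if_pos fun k => ?_
    have h1 := Int.floor_le (α * (m k : ℝ))
    have h2 := Int.lt_floor_add_one (α * (m k : ℝ))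
    simp only [slantPos, Pi.sub_apply, Int.cast_sub, Set.mem_Ico]
    constructor <;> linarith
  rw [← h]
  exact le_iSup₂ (f := fun m' n' => ‖slant α A (slantPos α m - n) m' n'‖ₑ) m n

theorem HasSummableSlants.exists_polySchurBound {α : ℝ} (hα : α ≠ 0) {s : ℝ} {r : ℕ}
    (hr : (r : ℝ) ≤ s) {A : OpMatrix 𝕜 d X Y} (hA : HasSummableSlants α (polyWeight d s) A) :
    ∃ C, PolySchurBound r (slantPos α) id A C := by
  have hK : 0 < ⌈|α⁻¹|⌉₊ := Nat.ceil_pos.2 (by positivity)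
  obtain ⟨N, hN⟩ := boundedFibres_slantPos (d := d) hα
  set g : (Fin d → ℤ) → ℝ≥0∞ := fun j =>
    supNorm (slant α A j) * ENNReal.ofReal (polyWeight d s j)
  have hfin : ∑' j, g j ≠ ∞ := by
    refine ne_top_of_le_ne_top hA.ne (le_mul_of_one_le_left' ?_)
    exact_mod_cast Nat.one_le_pow _ _ hK
  obtain ⟨S, hS⟩ : ∃ S : ℝ≥0, (S : ℝ≥0∞) = _ := ⟨_, ENNReal.coe_toNNReal hfin⟩
  -- The dominating kernel depends only on `⌊α m⌋ - n`: row sums are translates of the total sum,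
  -- column sums cost the fibre bound.
  refine ⟨(N + 1) * S, SchurBound.mono (k := fun m n => g (slantPos α m - n)) ⟨fun m => ?_,
    fun n => ?_⟩ fun m n => ?_⟩
  · have := (Equiv.subLeft (slantPos α m)).tsum_eq g
    simp only [Equiv.subLeft_apply] at this
    rw [this, ← hS]
    push_cast
    exact le_mul_of_one_le_left' le_add_self
  · refine (hN fun l => g (l - n)).trans ?_
    have := (Equiv.subRight n).tsum_eq g
    simp only [Equiv.subRight_apply] at this
    rw [this, ← hS]
    push_cast
    gcongr
    exact le_self_add
  · refine mul_le_mul' (enorm_le_supNorm_slant α A m n) (ENNReal.ofReal_le_ofReal ?_)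
    rw [polyWeight, ← Real.rpow_natCast]
    exact Real.rpow_le_rpow_of_exponent_le (by simp) hr

end Slants

end Slanted

end

theorem mainTheorem11 {𝕜 : Type*} [RCLike 𝕜] (d : ℕ)
    {HX HY : Type*}
    [NormedAddCommGroup HX] [InnerProductSpace 𝕜 HX] [CompleteSpace HX]
    [NormedAddCommGroup HY] [InnerProductSpace 𝕜 HY] [CompleteSpace HY]
    (α : ℝ) (hα : α ≠ 0) (s : ℝ) (hs : ((d : ℝ) + 1) ^ 2 < s)
    (A : Slanted.OpMatrix 𝕜 d HX HY)
    (hA : Slanted.HasSummableSlants α (Slanted.polyWeight d s) A)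
    (p : ℝ≥0∞) [Fact (1 ≤ p)] (hp : Slanted.IsBoundedBelow A p)
    (q : ℝ≥0∞) [Fact (1 ≤ q)] :
    ∃ T : Slanted.Ell d HX q →L[𝕜] Slanted.Ell d HY q,
      Slanted.IsOperatorOf A T ∧
      Submodule.ClosedComplemented (LinearMap.range (T : Slanted.Ell d HX q →ₗ[𝕜] Slanted.Ell d HY q)) := by
  have hds : ((d + 1 : ℕ) : ℝ) ≤ s := by
    have : (0 : ℝ) ≤ d := d.cast_nonneg
    push_cast
    nlinarith
  obtain ⟨C, hC⟩ := hA.exists_polySchurBound hα hds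
  obtain ⟨N, hN⟩ := Slanted.boundedFibres_slantPos (d := d) hα
  -- The exponent `2` is a detour, where Hilbert space adjoints provide the inverse.
  obtain ⟨T, hT, hTl⟩ := hC.exists_hasLeftInverse (hC.isBoundedBelow hN hp 2) q
  exact ⟨T, hT, hTl.closedComplemented_range⟩
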